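/- Let $n\ge 2$ be divisible by $4$, let $m\ge 2$, and let $k\ge 0$ be an integer. Consider $n$ deterministic asynchronous processes, any of which may crash (halt prematurely). They communicate by atomically reading and writing shared registers and by using wait-free consensus objects for $n/2$ processes. Such an object is invoked by at most $n/2$ processes, at most once by each of them. Every invocation proposes a value and returns a value, and the object returns to all its users one and the same value, which was proposed to it, no matter how many processes crash. Each process has an input from a fixed set of $m$ values and may decide, once, on a value of this set, whereupon it terminates. An algorithm solves the $(n,k)$-partial agreement problem and tolerates $t$ crash failures if * (agreement and weak validity) in every execution there is a value $v$, the input of at least one of the processes, such that at most $n-k$ processes decide on values other than $v$; * ($t$-resiliency) in every execution in which at most $t$ processes crash, each process that does not crash eventually decides. It satisfies strong validity if moreover, in every execution, every decided value is the input of some process. Then there exists an algorithm in this model that solves the $(n,k)$-partial agreement problem and tolerates $n/2$ crash failures if and only if $k\le 3n/4$. The same equivalence holds when strong validity is required in addition. -/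

import Mathlib

/-- The operation a process is about to perform, together with its successor local state as a
function of the response. Registers are named by `Reg` and hold values in `Val`; full agreement
(consensus) objects are named by `Obj` and work on values in `CVal`; decisions are in `α`. -/
inductive Op (State Reg Val Obj CVal α : Type) : Type
  /-- atomically read a shared register -/
  | read (r : Reg) (next : Val → State)
  /-- atomically write a shared register -/
  | write (r : Reg) (v : Val) (next : State)
  /-- propose a value to a full agreement object and receive its decision -/
  | propose (o : Obj) (v : CVal) (next : CVal → State)
  /-- decide on a value and terminate -/
  | decide (d : α)

/-- A deterministic algorithm for `n` asynchronous processes with inputs and decisions in `α`,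
which communicate through multi-writer multi-reader atomic registers and full agreement objects.
-/
structure Algorithm (n : ℕ) (α : Type) : Type 1 where
  /-- local states -/
  State : Type
  /-- names of the shared registers -/
  Reg : Type
  /-- contents of the shared registers -/
  Val : Type
  /-- names of the full agreement objects -/
  Obj : Type
  /-- values that can be proposed to the full agreement objects -/
  CVal : Type
  /-- initial contents of the registers -/
  regInit : Reg → Val
  /-- initial local state of a process with a given input -/
  start : Fin n → α → State
  /-- the code of each process -/
  op : Fin n → State → Op State Reg Val Obj CVal α

namespace Algorithm

variable {n : ℕ} {α : Type}

/-- A global configuration of the system. -/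
structure Config (A : Algorithm n α) : Type where
  /-- local state of each process -/
  state : Fin n → A.State
  /-- the decision of each process; `none` while it has not decided -/
  decision : Fin n → Option α
  /-- contents of each register -/
  reg : A.Reg → A.Val
  /-- the value agreed upon by each full agreement object; `none` before its first use -/
  agreed : A.Obj → Option A.CVal
  /-- the processes that have invoked each full agreement object, one entry per invocation -/
  users : A.Obj → Multiset (Fin n)

/-- The initial configuration for the input assignment `x`. -/
def initial (A : Algorithm n α) (x : Fin n → α) : A.Config where
  state p := A.start p (x p)
  decision _ := none
  reg := A.regInit
  agreed _ := none
  users _ := 0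

open Classical in
/-- One atomic step of process `p`. The first value proposed to a full agreement object is
returned to all its users. A step of a terminated process has no effect. -/
noncomputable def step (A : Algorithm n α) (p : Fin n) (c : A.Config) : A.Config :=
  match c.decision p with
  | some _ => c
  | none =>
    match A.op p (c.state p) with
    | .read r next => { c with state := Function.update c.state p (next (c.reg r)) }
    | .write r v next =>
        { c with
          state := Function.update c.state p next
          reg := Function.update c.reg r v }
    | .propose o v next =>
        { c with
          state := Function.update c.state p (next ((c.agreed o).getD v))
          agreed := Function.update c.agreed o (some ((c.agreed o).getD v))
          users := Function.update c.users o (p ::ₘ c.users o) }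
    | .decide d => { c with decision := Function.update c.decision p (some d) }

/-- The configuration reached after `i` steps, when the inputs are `x` and step number `j` is
taken by process `σ j`. -/
noncomputable def run (A : Algorithm n α) (x : Fin n → α) (σ : ℕ → Fin n) : ℕ → A.Config
  | 0 => A.initial x
  | i + 1 => A.step (σ i) (A.run x σ i)

/-- Process `p` decides on `d` in the execution with inputs `x` and schedule `σ`. -/
def Decides (A : Algorithm n α) (x : Fin n → α) (σ : ℕ → Fin n) (p : Fin n) (d : α) : Prop :=
  ∃ i, (A.run x σ i).decision p = some d

/-- Process `p` crashes (halts prematurely) in the execution with inputs `x` and schedule `σ`: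
it takes only finitely many steps and never decides. -/
def Crashes (A : Algorithm n α) (x : Fin n → α) (σ : ℕ → Fin n) (p : Fin n) : Prop :=
  {i | σ i = p}.Finite ∧ ∀ d, ¬ A.Decides x σ p d

/-- Every full agreement object is an object for `g` processes: in every execution it is invoked
by at most `g` processes, at most once by each of them. -/
def UsesObjectsFor (A : Algorithm n α) (g : ℕ) : Prop :=
  ∀ (x : Fin n → α) (σ : ℕ → Fin n) (i : ℕ) (o : A.Obj),
    ((A.run x σ i).users o).Nodup ∧ ((A.run x σ i).users o).card ≤ g

/-- Agreement and weak validity: in every execution there is a value `v`, the input of at least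
one process, such that at most `n - k` processes decide on values other than `v`. -/
def AgreementWeakValidity (A : Algorithm n α) (k : ℕ) : Prop :=
  ∀ (x : Fin n → α) (σ : ℕ → Fin n), ∃ v : α, (∃ q, x q = v) ∧
    {p | ∃ d, A.Decides x σ p d ∧ d ≠ v}.ncard + k ≤ n

/-- Strong validity: every decided value is the input of some process. -/
def StrongValidity (A : Algorithm n α) : Prop :=
  ∀ (x : Fin n → α) (σ : ℕ → Fin n) (p : Fin n) (d : α), A.Decides x σ p d → ∃ q, x q = d

/-- `t`-resiliency: in every execution with at most `t` crashes, each process that does not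
crash decides. -/
def Resilient (A : Algorithm n α) (t : ℕ) : Prop :=
  ∀ (x : Fin n → α) (σ : ℕ → Fin n), {p | A.Crashes x σ p}.ncard ≤ t →
    ∀ p, ¬ A.Crashes x σ p → ∃ d, A.Decides x σ p d

end Algorithm

/-- The `t`-resilient `(n, k)`-partial agreement problem with `m` possible input values and weak
validity is solvable with atomic registers and wait-free full agreement objects for `g`
processes. -/
def PartialAgreementSolvable (n k m t g : ℕ) : Prop :=
  ∃ A : Algorithm n (Fin m),
    A.UsesObjectsFor g ∧ A.AgreementWeakValidity k ∧ A.Resilient t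

/-- The same with strong validity. -/
def StrongPartialAgreementSolvable (n k m t g : ℕ) : Prop :=
  ∃ A : Algorithm n (Fin m),
    A.UsesObjectsFor g ∧ A.AgreementWeakValidity k ∧ A.StrongValidity ∧ A.Resilient t

/-!
Write `n = 4 * q`, so that objects serve `2 * q` processes and `2 * q` processes may crash.

*Impossibility* of `k > 3 * q` is a bivalence argument in the style of Fischer, Lynch and Paterson.
When all processes have decided, a single value has at most `q - 1` dissenters, so the decisions of
any `2 * q` processes determine this value (`Settled.eq_of_decision_eq`). Two configurations
which differ only in what processes of a set `S` know, and in an object that they have used, can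
therefore be continued to the same value, provided that at least `2 * q` processes can decide
without using that object (`Similar.exists_yields`). This is the case because the users of an object
together with the processes that are just about to use it number at most `2 * q`
(`UsesObjectsFor.card_union_poised_le`), and so may crash. Changing half of the inputs at a time
from one value to another, one finds an input assignment for which both values are possible. Two
adjacent steps of different processes commute up to such similarity (`similar_step_step`), so from a
configuration with two possible values any process can be made to take a step after which there are
still two. This results in a fair execution in which not all processes decide.

*Possibility* of `k = 3 * q` is wait-free. The processes form two groups of `2 * q`. Each group
agrees on an input, writes it to its register, reads the register of the other group, and agrees on
what was read. As each group writes before it reads, at least one group sees the other's value.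
A group that sees nothing decides on its own value. If the second group sees the value of the first
one, it adopts it; if the first group sees the value of the second one, only half of it does. In
each case at most `q` processes deviate from a common value (`Invariant.exists_common`).
-/

namespace Algorithm

variable {n : ℕ} {α : Type} {A : Algorithm n α}

/-! ### Finite executions -/

/-- The configuration reached from `c` when the processes in `l` take one step each, in order. -/
noncomputable def exec (A : Algorithm n α) (c : A.Config) (l : List (Fin n)) : A.Config :=
  l.foldl (fun c p => A.step p c) c

@[simp] lemma exec_nil (c : A.Config) : A.exec c [] = c := rfl

@[simp] lemma exec_cons (c : A.Config) (p : Fin n) (l : List (Fin n)) :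
    A.exec c (p :: l) = A.exec (A.step p c) l := rfl

lemma exec_append (c : A.Config) (l l' : List (Fin n)) :
    A.exec c (l ++ l') = A.exec (A.exec c l) l' :=
  List.foldl_append

lemma run_eq_exec (x : Fin n → α) (σ : ℕ → Fin n) (i : ℕ) :
    A.run x σ i = A.exec (A.initial x) ((List.range i).map σ) := by
  induction i with
  | zero => rfl
  | succ i ih => simp [run, ih, List.range_succ, exec_append]

lemma step_eq_self_of_decision {c : A.Config} {p : Fin n} {d : α} (h : c.decision p = some d) :
    A.step p c = c := by
  simp [step, h]

lemma step_state_of_ne {c : A.Config} {p q : Fin n} (h : q ≠ p) :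
    (A.step p c).state q = c.state q := by
  unfold step
  split
  · rfl
  · split <;> simp [h]

lemma step_decision_of_ne {c : A.Config} {p q : Fin n} (h : q ≠ p) :
    (A.step p c).decision q = c.decision q := by
  unfold step
  split
  · rfl
  · split <;> simp [h]

lemma step_decision_eq_some {c : A.Config} {p q : Fin n} {d : α} (h : c.decision q = some d) :
    (A.step p c).decision q = some d := by
  by_cases hq : q = p
  · subst hq
    rw [step_eq_self_of_decision h, h]
  · rw [step_decision_of_ne hq, h]

lemma users_le_step (c : A.Config) (p : Fin n) (o : A.Obj) :
    c.users o ≤ (A.step p c).users o := by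
  unfold step
  split
  · rfl
  · split
    · rfl
    · rfl
    · rename_i o' _ _ _
      by_cases h : o = o'
      · subst h
        simp [Multiset.le_cons_self]
      · simp [h]
    · rfl

lemma exec_decision_eq_some {c : A.Config} {q : Fin n} {d : α} (l : List (Fin n))
    (h : c.decision q = some d) : (A.exec c l).decision q = some d := by
  induction l generalizing c with
  | nil => exact h
  | cons p l ih => exact ih (step_decision_eq_some h)

lemma users_le_exec (c : A.Config) (l : List (Fin n)) (o : A.Obj) :
    c.users o ≤ (A.exec c l).users o := by
  induction l generalizing c with
  | nil => exact le_rfl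
  | cons p l ih => exact (users_le_step c p o).trans (ih _)

lemma run_decision_eq_some_of_le {x : Fin n → α} {σ : ℕ → Fin n} {i j : ℕ} (hij : i ≤ j)
    {p : Fin n} {d : α} (h : (A.run x σ i).decision p = some d) :
    (A.run x σ j).decision p = some d := by
  induction j, hij using Nat.le_induction with
  | base => exact h
  | succ j _ ih => exact step_decision_eq_some ih

/-- Finitely many processes decide, so all decisions of an execution are taken by some time. -/
lemma exists_forall_decides (A : Algorithm n α) (x : Fin n → α) (σ : ℕ → Fin n) :
    ∃ i, ∀ p d, A.Decides x σ p d → (A.run x σ i).decision p = some d := by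
  have h : ∀ p, ∃ i, ∀ d, A.Decides x σ p d → (A.run x σ i).decision p = some d := by
    intro p
    by_cases hp : ∃ d, A.Decides x σ p d
    · obtain ⟨d, i, hi⟩ := hp
      refine ⟨i, fun d' ⟨j, hj⟩ => ?_⟩
      have h1 := run_decision_eq_some_of_le (le_max_left i j) hi
      have h2 := run_decision_eq_some_of_le (le_max_right i j) hj
      rw [hi, ← h1, h2]
    · exact ⟨0, fun d hd => absurd ⟨d, hd⟩ hp⟩
  choose f hf using h
  refine ⟨Finset.univ.sup f, fun p d hd => ?_⟩
  exact run_decision_eq_some_of_le (Finset.le_sup (Finset.mem_univ p)) (hf p d hd)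

/-- `c` occurs in some execution. -/
def Reachable (A : Algorithm n α) (c : A.Config) : Prop :=
  ∃ x l, c = A.exec (A.initial x) l

lemma reachable_initial (x : Fin n → α) : A.Reachable (A.initial x) := ⟨x, [], rfl⟩

lemma Reachable.exec {c : A.Config} (h : A.Reachable c) (l : List (Fin n)) :
    A.Reachable (A.exec c l) := by
  obtain ⟨x, l', rfl⟩ := h
  exact ⟨x, l' ++ l, (exec_append _ _ _).symm⟩

lemma Reachable.step {c : A.Config} (h : A.Reachable c) (p : Fin n) :
    A.Reachable (A.step p c) := h.exec [p]

/-- A finite execution can be continued by any schedule. -/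
lemma exists_run_eq (A : Algorithm n α) (x : Fin n → α) (l : List (Fin n)) (σ : ℕ → Fin n) :
    ∃ τ : ℕ → Fin n, (∀ i, τ (l.length + i) = σ i) ∧
      ∀ i, A.run x τ (l.length + i) =
        A.exec (A.exec (A.initial x) l) ((List.range i).map σ) := by
  refine ⟨fun j => if h : j < l.length then l[j] else σ (j - l.length), by simp, fun i => ?_⟩
  rw [run_eq_exec, ← exec_append, List.range_add, List.map_append, List.map_map]
  congr 2
  · apply List.ext_getElem <;> simp +contextual
  · apply List.map_congr_left
    simp

/-! ### Fair schedules -/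

/-- A nonempty set of processes can be scheduled fairly, with no steps of other processes. -/
lemma exists_fair_schedule {R : Finset (Fin n)} (hR : R.Nonempty) :
    ∃ σ : ℕ → Fin n, (∀ i, σ i ∈ R) ∧ ∀ p ∈ R, {i | σ i = p}.Infinite := by
  have : Nonempty R := hR.to_subtype
  obtain ⟨f, hf⟩ := exists_surjective_nat (ℕ × R)
  refine ⟨fun i => (f i).2, fun i => (f i).2.2, fun p hp hfin => ?_⟩
  have hsub : Set.range (fun k : ℕ => (k, (⟨p, hp⟩ : R))) ⊆ f '' {i | ((f i).2 : Fin n) = p} := by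
    rintro _ ⟨k, rfl⟩
    obtain ⟨i, hi⟩ := hf (k, ⟨p, hp⟩)
    exact ⟨i, by simp [hi], hi⟩
  exact Set.infinite_range_of_injective (fun a b h => (Prod.ext_iff.1 h).1)
    ((hfin.image f).subset hsub)

/-- If all processes outside `R` may crash, then in a fair execution of `R` all of `R` decides. -/
lemma Resilient.exists_decided {t : ℕ} (hres : A.Resilient t) {c : A.Config}
    (hc : A.Reachable c) {R : Finset (Fin n)} (hR : Rᶜ.card ≤ t) {σ : ℕ → Fin n}
    (hσ : ∀ p ∈ R, {i | σ i = p}.Infinite) :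
    ∃ i, ∀ p ∈ R, ∃ d, (A.exec c ((List.range i).map σ)).decision p = some d := by
  obtain ⟨x, l, rfl⟩ := hc
  obtain ⟨τ, hτ, hrun⟩ := A.exists_run_eq x l σ
  have hcr : ∀ p ∈ R, ¬ A.Crashes x τ p := by
    intro p hp h
    refine hσ p hp (((h.1.preimage (f := fun i => l.length + i)
      (fun a _ b _ h => by simpa using h))).subset fun i hi => ?_)
    simpa [hτ] using hi
  have hcard : {p | A.Crashes x τ p}.ncard ≤ t := by
    refine le_trans ?_ hR
    rw [← Set.ncard_coe_finset]
    refine Set.ncard_le_ncard (fun p hp => ?_) (Set.toFinite _)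
    simp only [Finset.coe_compl, Set.mem_compl_iff, Finset.mem_coe]
    exact fun h => hcr p h hp
  obtain ⟨i, hi⟩ := A.exists_forall_decides x τ
  refine ⟨i, fun p hp => ?_⟩
  obtain ⟨d, hd⟩ := hres x τ hcard p (hcr p hp)
  refine ⟨d, ?_⟩
  rw [← hrun]
  exact run_decision_eq_some_of_le (Nat.le_add_left i _) (hi p d hd)

/-! ### Valency -/

/-- All processes have decided in `c`, at least `k` of them on `v`. -/
def Settled (A : Algorithm n α) (k : ℕ) (c : A.Config) (v : α) : Prop :=
  (∀ p, ∃ d, c.decision p = some d) ∧ {p | c.decision p ≠ some v}.ncard + k ≤ n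

/-- Some continuation of `c` is settled on `v`. -/
def Yields (A : Algorithm n α) (k : ℕ) (c : A.Config) (v : α) : Prop :=
  ∃ l, A.Settled k (A.exec c l) v

/-- Two different values are still possible in `c`. -/
def Bivalent (A : Algorithm n α) (k : ℕ) (c : A.Config) : Prop :=
  ∃ v w, v ≠ w ∧ A.Yields k c v ∧ A.Yields k c w

lemma Yields.of_exec {k : ℕ} {c : A.Config} {l : List (Fin n)} {v : α}
    (h : A.Yields k (A.exec c l) v) : A.Yields k c v := by
  obtain ⟨l', h⟩ := h
  exact ⟨l ++ l', by rwa [exec_append]⟩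

/-- If `R` is so large that any two sets of at least `k` processes have a common element in `R`,
then the decisions of `R` determine the value. -/
lemma Settled.eq_of_decision_eq {k : ℕ} {c c' : A.Config} {v w : α} (hc : A.Settled k c v)
    (hc' : A.Settled k c' w) {R : Finset (Fin n)} (hR : 2 * n < R.card + 2 * k)
    (h : ∀ p ∈ R, c.decision p = c'.decision p) : v = w := by
  by_contra hvw
  have hsub : (R : Set (Fin n)) ⊆
      {p | c.decision p ≠ some v} ∪ {p | c'.decision p ≠ some w} := by
    intro p hp
    by_contra hn
    simp only [Set.mem_union, Set.mem_ofPred_eq, not_or, not_not] at hn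
    have := h p hp
    rw [hn.1, hn.2] at this
    exact hvw (Option.some.inj this)
  have h1 := (Set.ncard_le_ncard hsub (Set.toFinite _)).trans (Set.ncard_union_le _ _)
  rw [Set.ncard_coe_finset] at h1
  have h2 := hc.2
  have h3 := hc'.2
  omega

lemma exec_eq_self_of_forall_decision {c : A.Config} (h : ∀ p, ∃ d, c.decision p = some d)
    (l : List (Fin n)) : A.exec c l = c := by
  induction l with
  | nil => rfl
  | cons p l ih =>
    obtain ⟨d, hd⟩ := h p
    rw [exec_cons, step_eq_self_of_decision hd, ih]

/-- Agreement and weak validity, restated for finite executions in which all processes decide. -/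
lemma AgreementWeakValidity.exists_settled [Nonempty (Fin n)] {k : ℕ}
    (hA : A.AgreementWeakValidity k)
    {x : Fin n → α} {l : List (Fin n)}
    (h : ∀ p, ∃ d, (A.exec (A.initial x) l).decision p = some d) :
    ∃ v, (∃ q, x q = v) ∧ A.Settled k (A.exec (A.initial x) l) v := by
  obtain ⟨p₀⟩ := ‹Nonempty (Fin n)›
  obtain ⟨τ, -, hτ⟩ := A.exists_run_eq x l (fun _ => p₀)
  obtain ⟨v, hv, hcard⟩ := hA x τ
  refine ⟨v, hv, h, le_trans (Nat.add_le_add_right (Set.ncard_le_ncard ?_ (Set.toFinite _)) _)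
    hcard⟩
  intro p hp
  obtain ⟨d, hd⟩ := h p
  refine ⟨d, ⟨l.length, ?_⟩, fun hdv => hp (hdv ▸ hd)⟩
  simpa [hd] using congrArg (fun c => c.decision p) (hτ 0)

lemma exists_yields [Nonempty (Fin n)] {k t : ℕ} (hA : A.AgreementWeakValidity k)
    (hres : A.Resilient t) {c : A.Config} (hc : A.Reachable c) : ∃ v, A.Yields k c v := by
  obtain ⟨σ, -, hσ⟩ := exists_fair_schedule (Finset.univ_nonempty (α := Fin n))
  obtain ⟨i, hi⟩ := hres.exists_decided hc (by simp) hσ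
  obtain ⟨x, l, rfl⟩ := hc
  rw [← exec_append] at hi
  obtain ⟨v, -, hv⟩ := hA.exists_settled fun p => hi p (Finset.mem_univ p)
  exact ⟨v, (List.range i).map σ, by rwa [← exec_append]⟩

/-! ### Configurations that some processes cannot tell apart -/

/-- `c` and `c'` differ at most in the local states and decisions of processes in `S` and in the
values agreed upon by objects in `F`. -/
structure Similar (S : Finset (Fin n)) (F : Set A.Obj) (c c' : A.Config) : Prop where
  state : ∀ p ∉ S, c.state p = c'.state p
  decision : ∀ p ∉ S, c.decision p = c'.decision p
  reg : c.reg = c'.reg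
  agreed : ∀ o ∉ F, c.agreed o = c'.agreed o

/-- Process `p` has not decided and its next operation invokes an object in `F`. -/
def Poised (c : A.Config) (F : Set A.Obj) (p : Fin n) : Prop :=
  c.decision p = none ∧ ∃ o v next, A.op p (c.state p) = .propose o v next ∧ o ∈ F

lemma Poised.step_of_ne {c : A.Config} {F : Set A.Obj} {p q : Fin n} (h : Poised c F q)
    (hqp : q ≠ p) : Poised (A.step p c) F q := by
  unfold Poised
  rwa [step_decision_of_ne hqp, step_state_of_ne hqp]

/-- A process whose next operation does not distinguish similar configurations preserves
similarity. -/
lemma Similar.step {S : Finset (Fin n)} {F : Set A.Obj} {c c' : A.Config}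
    (h : Similar S F c c') {p : Fin n} (hp : p ∉ S) (hF : ¬ Poised c F p) :
    Similar S F (A.step p c) (A.step p c') := by
  have hs := h.state p hp
  have hd := h.decision p hp
  have hr := h.reg
  cases hdp : c.decision p with
  | some d =>
    rw [step_eq_self_of_decision hdp, step_eq_self_of_decision (hd ▸ hdp)]
    exact h
  | none =>
    have hdp' := hd ▸ hdp
    cases hop : A.op p (c.state p) with
    | read r next =>
      have hop' := hs ▸ hop
      simp only [Algorithm.step, hdp, hdp', hop, hop', hr]
      refine ⟨fun q hq => ?_, h.decision, rfl, h.agreed⟩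
      by_cases hqp : q = p
      · subst hqp; simp
      · simp [hqp, h.state q hq]
    | write r v next =>
      have hop' := hs ▸ hop
      simp only [Algorithm.step, hdp, hdp', hop, hop', hr]
      refine ⟨fun q hq => ?_, h.decision, rfl, h.agreed⟩
      by_cases hqp : q = p
      · subst hqp; simp
      · simp [hqp, h.state q hq]
    | propose o v next =>
      have hop' := hs ▸ hop
      have ho : o ∉ F := fun ho => hF ⟨hdp, o, v, next, hop, ho⟩
      simp only [Algorithm.step, hdp, hdp', hop, hop', h.agreed o ho]
      refine ⟨fun q hq => ?_, h.decision, hr, fun o' ho' => ?_⟩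
      · by_cases hqp : q = p
        · subst hqp; simp
        · simp [hqp, h.state q hq]
      · by_cases hoo : o' = o
        · subst hoo; simp
        · simp [hoo, h.agreed o' ho']
    | decide d =>
      have hop' := hs ▸ hop
      simp only [Algorithm.step, hdp, hdp', hop, hop']
      refine ⟨h.state, fun q hq => ?_, hr, h.agreed⟩
      by_cases hqp : q = p
      · subst hqp; simp
      · simp [hqp, h.decision q hq]

open Classical in
/-- If two configurations are similar, and the processes that could tell them apart together with
those that are about to do so never number more than `t`, then a common value is possible in both:
the remaining processes may be the only ones that take further steps. -/
lemma Similar.exists_yields [Nonempty (Fin n)] {k t : ℕ} (hA : A.AgreementWeakValidity k)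
    (hres : A.Resilient t) (hk : n + t < 2 * k) (htn : t < n)
    {S : Finset (Fin n)} {F : Set A.Obj} {c c' : A.Config} (hc : A.Reachable c)
    (hc' : A.Reachable c') (h : Similar S F c c')
    (hS : ∀ l, (S ∪ Finset.univ.filter (Poised (A.exec c l) F)).card ≤ t) :
    ∃ v, A.Yields k c v ∧ A.Yields k c' v := by
  -- Advance both configurations until as many processes as possible are poised outside `S`.
  let B : List (Fin n) → Finset (Fin n) := fun l =>
    S ∪ Finset.univ.filter (Poised (A.exec c l) F)
  obtain ⟨l₀, hl₀, hmax⟩ : ∃ l₀, Similar S F (A.exec c l₀) (A.exec c' l₀) ∧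
      ∀ l, Similar S F (A.exec c l) (A.exec c' l) → (B l).card ≤ (B l₀).card := by
    let P : ℕ → Prop := fun b => ∃ l, Similar S F (A.exec c l) (A.exec c' l) ∧ (B l).card = b
    have hP : ∃ b, P b := ⟨_, [], h, rfl⟩
    have hbound : ∀ b, P b → b ≤ t := by
      rintro b ⟨l, -, rfl⟩
      exact hS l
    obtain ⟨b₀, hb₀⟩ := hP
    obtain ⟨l₀, hl₀, hb⟩ := Nat.findGreatest_spec (hbound b₀ hb₀) hb₀
    exact ⟨l₀, hl₀, fun l hl => hb ▸ Nat.le_findGreatest (hS l) ⟨l, hl, rfl⟩⟩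
  have hRt : ((B l₀)ᶜ)ᶜ.card ≤ t := by
    rw [compl_compl]
    exact hS l₀
  have hRcard : n ≤ (B l₀)ᶜ.card + t := by
    have h1 := Finset.card_compl_add_card (B l₀)
    have h2 : (B l₀).card ≤ t := hS l₀
    rw [Fintype.card_fin] at h1
    omega
  have hRne : ((B l₀)ᶜ).Nonempty := by
    rw [← Finset.card_pos]
    omega
  obtain ⟨σ, hσR, hσ⟩ := exists_fair_schedule hRne
  -- By maximality no further process becomes poised, so the similarity persists.
  have hsim : ∀ i, Similar S F (A.exec c (l₀ ++ (List.range i).map σ))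
      (A.exec c' (l₀ ++ (List.range i).map σ)) ∧ B (l₀ ++ (List.range i).map σ) = B l₀ := by
    intro i
    induction i with
    | zero => simpa using hl₀
    | succ i ih =>
      obtain ⟨ih, hB⟩ := ih
      have hi : σ i ∉ B (l₀ ++ (List.range i).map σ) := by
        rw [hB]
        exact Finset.mem_compl.1 (hσR i)
      have hmem := hi
      simp only [B, Finset.mem_union, Finset.mem_filter, Finset.mem_univ, true_and,
        not_or] at hmem
      have hstep := ih.step hmem.1 hmem.2
      have hl : l₀ ++ (List.range (i + 1)).map σ = (l₀ ++ (List.range i).map σ) ++ [σ i] := by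
        simp [List.range_succ]
      rw [hl, exec_append _ _ [σ i], exec_append _ _ [σ i]]
      refine ⟨hstep, ?_⟩
      have hsub : B l₀ ⊆ B ((l₀ ++ (List.range i).map σ) ++ [σ i]) := by
        rw [← hB]
        refine Finset.union_subset_union_right fun q hq => ?_
        simp only [Finset.mem_filter, Finset.mem_univ, true_and] at hq ⊢
        rw [exec_append _ _ [σ i]]
        exact hq.step_of_ne fun hqi => hmem.2 (hqi ▸ hq)
      refine (Finset.eq_of_subset_of_card_le hsub (hmax _ ?_)).symm
      rw [exec_append _ _ [σ i], exec_append _ _ [σ i]]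
      exact hstep
  obtain ⟨i, hi⟩ := hres.exists_decided (hc.exec l₀) hRt hσ
  rw [← exec_append] at hi
  obtain ⟨hsi, -⟩ := hsim i
  obtain ⟨v, l, hv⟩ := Algorithm.exists_yields hA hres (hc.exec (l₀ ++ (List.range i).map σ))
  obtain ⟨w, l', hw⟩ := Algorithm.exists_yields hA hres (hc'.exec (l₀ ++ (List.range i).map σ))
  have hvw : v = w := by
    refine hv.eq_of_decision_eq hw (R := (B l₀)ᶜ) (by omega) fun p hp => ?_
    obtain ⟨d, hd⟩ := hi p hp
    have hpS : p ∉ S := fun hpS => Finset.mem_compl.1 hp (Finset.mem_union_left _ hpS)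
    rw [exec_decision_eq_some l hd, exec_decision_eq_some l' (hsi.decision p hpS ▸ hd)]
  subst hvw
  exact ⟨v, .of_exec ⟨l, hv⟩, .of_exec ⟨l', hw⟩⟩

/-! ### Adjacent steps of different processes -/

open Classical in
lemma filter_poised_empty (c : A.Config) : Finset.univ.filter (Poised c ∅) = ∅ :=
  Finset.filter_false_of_mem fun _ _ h => by
    obtain ⟨-, _, _, _, -, ho⟩ := h
    exact ho

lemma Poised.mem_users_step {c : A.Config} {o : A.Obj} {p : Fin n} (h : Poised c {o} p) :
    p ∈ (A.step p c).users o := by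
  obtain ⟨hd, o', v, next, hop, rfl⟩ := h
  simp [step, hd, hop]

lemma mem_users_exec_of_poised {o : A.Obj} {l : List (Fin n)} (hl : l.Nodup) {c : A.Config}
    (h : ∀ p ∈ l, Poised c {o} p) : ∀ p ∈ l, p ∈ (A.exec c l).users o := by
  induction l generalizing c with
  | nil => simp
  | cons q l ih =>
    rw [List.nodup_cons] at hl
    intro p hp
    rcases List.mem_cons.1 hp with rfl | hp
    · exact Multiset.mem_of_le (users_le_exec _ l o) (h p (by simp)).mem_users_step
    · refine ih hl.2 (fun r hr => ?_) p hp
      exact (h r (by simp [hr])).step_of_ne (ne_of_mem_of_not_mem hr hl.1)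

open Classical in
/-- The processes that have invoked an object or are about to do so number at most `g`: in some
continuation all of them are among its users. -/
lemma UsesObjectsFor.card_union_poised_le {g : ℕ} (hg : A.UsesObjectsFor g) [Nonempty (Fin n)]
    {c : A.Config} (hc : A.Reachable c) {o : A.Obj} {S : Finset (Fin n)}
    (hS : ∀ p ∈ S, p ∈ c.users o) (l : List (Fin n)) :
    (S ∪ Finset.univ.filter (Poised (A.exec c l) {o})).card ≤ g := by
  let Q := (Finset.univ.filter (Poised (A.exec c l) {o})).toList
  obtain ⟨x, l', hx⟩ := hc.exec (l ++ Q)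
  obtain ⟨p₀⟩ := ‹Nonempty (Fin n)›
  obtain ⟨τ, -, hτ⟩ := A.exists_run_eq x l' (fun _ => p₀)
  have h0 : A.run x τ l'.length = A.exec c (l ++ Q) := by simpa [hx] using hτ 0
  have hcard := (hg x τ l'.length o).2
  rw [h0] at hcard
  refine le_trans (le_trans (Finset.card_le_card ?_) (Multiset.toFinset_card_le _)) hcard
  intro p hp
  rw [Multiset.mem_toFinset]
  rcases Finset.mem_union.1 hp with hp | hp
  · exact Multiset.mem_of_le (users_le_exec c _ o) (hS p hp)
  · rw [exec_append]
    refine mem_users_exec_of_poised (Finset.nodup_toList _) (fun q hq => ?_) p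
      (Finset.mem_toList.2 hp)
    exact (Finset.mem_filter.1 (Finset.mem_toList.1 hq)).2

lemma Similar.of_eq {S : Finset (Fin n)} {F : Set A.Obj} {c c' : A.Config} (h : c = c') :
    Similar S F c c' := by
  subst h
  exact ⟨fun _ _ => rfl, fun _ _ => rfl, rfl, fun _ _ => rfl⟩

/-- Steps of different processes commute up to the local states of the two processes. There are two
exceptions: a write hides an earlier write to the same register, and two invocations of the same
object also affect the value it has agreed upon. -/
lemma similar_step_step (c : A.Config) {p q : Fin n} (hpq : p ≠ q) :
    Similar {p, q} ∅ (A.step q (A.step p c)) (A.step p (A.step q c)) ∨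
      Similar {p, q} ∅ (A.step p c) (A.step p (A.step q c)) ∨
      ∃ o, Similar {p, q} {o} (A.step q (A.step p c)) (A.step p (A.step q c)) ∧
        p ∈ (A.step q (A.step p c)).users o ∧ q ∈ (A.step q (A.step p c)).users o := by
  classical
  cases hdp : c.decision p with
  | some d =>
    left
    apply Similar.of_eq
    rw [step_eq_self_of_decision hdp, step_eq_self_of_decision (step_decision_eq_some hdp)]
  | none =>
  cases hdq : c.decision q with
  | some d =>
    left
    apply Similar.of_eq
    rw [step_eq_self_of_decision hdq, step_eq_self_of_decision (step_decision_eq_some hdq)]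
  | none =>
  have hqp := hpq.symm
  have hst : ∀ r ∉ ({p, q} : Finset (Fin n)),
      (A.step q (A.step p c)).state r = (A.step p (A.step q c)).state r := by
    intro r hr
    simp only [Finset.mem_insert, Finset.mem_singleton, not_or] at hr
    rw [step_state_of_ne hr.1, step_state_of_ne hr.2, step_state_of_ne hr.2,
      step_state_of_ne hr.1]
  have hde : ∀ r ∉ ({p, q} : Finset (Fin n)),
      (A.step q (A.step p c)).decision r = (A.step p (A.step q c)).decision r := by
    intro r hr
    simp only [Finset.mem_insert, Finset.mem_singleton, not_or] at hr
    rw [step_decision_of_ne hr.1, step_decision_of_ne hr.2, step_decision_of_ne hr.2,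
      step_decision_of_ne hr.1]
  have hst' : ∀ r ∉ ({p, q} : Finset (Fin n)),
      (A.step p c).state r = (A.step p (A.step q c)).state r := by
    intro r hr
    simp only [Finset.mem_insert, Finset.mem_singleton, not_or] at hr
    rw [step_state_of_ne hr.1, step_state_of_ne hr.1, step_state_of_ne hr.2]
  have hde' : ∀ r ∉ ({p, q} : Finset (Fin n)),
      (A.step p c).decision r = (A.step p (A.step q c)).decision r := by
    intro r hr
    simp only [Finset.mem_insert, Finset.mem_singleton, not_or] at hr
    rw [step_decision_of_ne hr.1, step_decision_of_ne hr.1, step_decision_of_ne hr.2]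
  cases hp : A.op p (c.state p) <;> cases hq : A.op q (c.state q)
  case write.write r v next r' v' next' =>
    by_cases hr : r = r'
    · subst hr
      right; left
      refine ⟨hst', hde', ?_, ?_⟩ <;> simp [step, hdp, hdq, hp, hq, hpq]
    · left
      refine ⟨hst, hde, ?_, ?_⟩ <;>
        simp [step, hdp, hdq, hp, hq, hpq, hqp, Function.update_comm hr]
  case propose.propose o v next o' v' next' =>
    by_cases ho : o = o'
    · subst ho
      right; right
      refine ⟨o, ⟨hst, hde, ?_, ?_⟩, ?_, ?_⟩ <;>
        simp +contextual [step, hdp, hdq, hp, hq, hpq, hqp]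
    · left
      refine ⟨hst, hde, ?_, ?_⟩ <;>
        simp [step, hdp, hdq, hp, hq, hpq, hqp, ho, Ne.symm ho, Function.update_comm ho]
  all_goals
    left
    refine ⟨hst, hde, ?_, ?_⟩ <;> simp [step, hdp, hdq, hp, hq, hpq, hqp]

/-! ### Impossibility -/

/-- If every continuation in which `p` takes a step is univalent, then every value that is possible
is still possible after a step of `p`: the step of `p` can be moved forward across the steps of the
other processes one by one, as it commutes with each of them up to configurations which
sufficiently many processes cannot tell apart. -/
lemma yields_step_of_not_bivalent [Nonempty (Fin n)] {k g : ℕ} (hA : A.AgreementWeakValidity k)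
    (hres : A.Resilient g) (hobj : A.UsesObjectsFor g) (hg : 2 ≤ g) (hgn : g < n)
    (hk : n + g < 2 * k) {p : Fin n} {v : α} {l : List (Fin n)} {c : A.Config}
    (hc : A.Reachable c) (hb : ∀ l, p ∈ l → ¬ A.Bivalent k (A.exec c l))
    (hv : A.Settled k (A.exec c l) v) : A.Yields k (A.step p c) v := by
  induction l generalizing c with
  | nil =>
    obtain ⟨d, hd⟩ := hv.1 p
    rw [exec_nil] at hd hv
    rw [step_eq_self_of_decision hd]
    exact ⟨[], hv⟩
  | cons q l ih =>
    have ih := ih (hc.step q) (fun l hl => hb (q :: l) (List.mem_cons_of_mem _ hl)) hv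
    by_cases hpq : p = q
    · subst hpq
      exact Yields.of_exec (l := [p]) ih
    have huniv : ∀ w, A.Yields k (A.step p (A.step q c)) w → w = v := by
      intro w hw
      by_contra hne
      exact hb [q, p] (by simp) ⟨w, v, hne, hw, ih⟩
    rcases similar_step_step c hpq with h | h | ⟨o, h, hpo, hqo⟩
    · obtain ⟨w, hw, hw'⟩ := h.exists_yields hA hres hk hgn ((hc.step p).step q)
        ((hc.step q).step p) fun l => by
          rw [filter_poised_empty, Finset.union_empty]
          exact Finset.card_le_two.trans hg
      rw [huniv w hw'] at hw
      exact Yields.of_exec (l := [q]) hw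
    · obtain ⟨w, hw, hw'⟩ := h.exists_yields hA hres hk hgn (hc.step p)
        ((hc.step q).step p) fun l => by
          rw [filter_poised_empty, Finset.union_empty]
          exact Finset.card_le_two.trans hg
      rwa [huniv w hw'] at hw
    · obtain ⟨w, hw, hw'⟩ := h.exists_yields hA hres hk hgn ((hc.step p).step q)
        ((hc.step q).step p) (fun l => hobj.card_union_poised_le ((hc.step p).step q)
          (by simp [hpo, hqo]) l)
      rw [huniv w hw'] at hw
      exact Yields.of_exec (l := [q]) hw

/-- A bivalent configuration can be continued with a step of any given process so that it stays
bivalent. -/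
lemma exists_bivalent_exec [Nonempty (Fin n)] {k g : ℕ} (hA : A.AgreementWeakValidity k)
    (hres : A.Resilient g) (hobj : A.UsesObjectsFor g) (hg : 2 ≤ g) (hgn : g < n)
    (hk : n + g < 2 * k) (p : Fin n) {c : A.Config} (hc : A.Reachable c)
    (hb : A.Bivalent k c) : ∃ l, p ∈ l ∧ A.Bivalent k (A.exec c l) := by
  by_contra! hcon
  obtain ⟨v, w, hvw, ⟨l, hl⟩, ⟨l', hl'⟩⟩ := hb
  exact hcon [p] (by simp) ⟨v, w, hvw,
    yields_step_of_not_bivalent hA hres hobj hg hgn hk hc hcon hl,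
    yields_step_of_not_bivalent hA hres hobj hg hgn hk hc hcon hl'⟩

/-- A property of finite schedules that can be restored after a step of any given process holds
infinitely often along some fair schedule. -/
lemma exists_schedule_of_lists [Nonempty (Fin n)] {P : List (Fin n) → Prop} (h₀ : P [])
    (h : ∀ l p, P l → ∃ l', p ∈ l' ∧ P (l ++ l')) :
    ∃ σ : ℕ → Fin n, (∀ p, {i | σ i = p}.Infinite) ∧
      ∀ N, ∃ i, N ≤ i ∧ P ((List.range i).map σ) := by
  obtain ⟨ρ, -, hρ⟩ := exists_fair_schedule (Finset.univ_nonempty (α := Fin n))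
  have h' : ∀ (l : {l // P l}) p, ∃ l', p ∈ l' ∧ P (l.1 ++ l') := fun l p => h l.1 p l.2
  choose f hf hPf using h'
  let L : ℕ → {l // P l} := fun i =>
    Nat.rec ⟨[], h₀⟩ (fun i l => ⟨l.1 ++ f l (ρ i), hPf l (ρ i)⟩) i
  have hL : ∀ i, (L (i + 1)).1 = (L i).1 ++ f (L i) (ρ i) := fun _ => rfl
  have hlen : ∀ i, i ≤ (L i).1.length := by
    intro i
    induction i with
    | zero => exact Nat.zero_le _
    | succ i ih =>
      have := List.length_pos_of_mem (hf (L i) (ρ i))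
      rw [hL, List.length_append]
      omega
  have hpre : ∀ i j, i ≤ j → (L i).1 <+: (L j).1 := by
    intro i j hij
    induction j, hij using Nat.le_induction with
    | base => exact List.prefix_rfl
    | succ j _ ih => exact ih.trans (hL j ▸ List.prefix_append _ _)
  let σ : ℕ → Fin n := fun j => (L (j + 1)).1[j]'(hlen (j + 1))
  have hσ : ∀ i j (hj : j < (L i).1.length),
      σ j = (L i).1[j] := by
    intro i j hj
    rcases le_total i (j + 1) with hij | hij
    · exact ((hpre _ _ hij).getElem hj).symm
    · exact (hpre _ _ hij).getElem (hlen (j + 1))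
  refine ⟨σ, fun p => ?_, fun N => ⟨(L N).1.length, hlen N, ?_⟩⟩
  · refine Set.infinite_of_forall_exists_gt fun N => ?_
    obtain ⟨i, hi, hNi⟩ := (hρ p (Finset.mem_univ p)).exists_gt N
    have hi : ρ i = p := hi
    obtain ⟨j, hj, hjp⟩ := List.getElem_of_mem (hf (L i) (ρ i))
    refine ⟨(L i).1.length + j, ?_, ?_⟩
    · have hlt : (L i).1.length + j < (L (i + 1)).1.length := by
        rw [hL, List.length_append]
        omega
      change σ _ = p
      rw [hσ (i + 1) _ hlt]
      simp only [hL]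
      rw [List.getElem_append_right (Nat.le_add_right _ _)]
      simpa [hi] using hjp
    · have := hlen i
      omega
  · have : (List.range (L N).1.length).map σ = (L N).1 := by
      apply List.ext_getElem
      · simp
      · intro j h1 h2
        simp [hσ N j h2]
    rw [this]
    exact (L N).2

/-- No initial configuration is bivalent: it would start a fair execution which passes through
bivalent configurations again and again, so that not all processes decide. -/
lemma not_bivalent_initial [Nonempty (Fin n)] {k g : ℕ} (hA : A.AgreementWeakValidity k)
    (hres : A.Resilient g) (hobj : A.UsesObjectsFor g) (hg : 2 ≤ g) (hgn : g < n)
    (hk : n + g < 2 * k) (x : Fin n → α) : ¬ A.Bivalent k (A.initial x) := by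
  intro hb
  obtain ⟨σ, hσ, hbiv⟩ := exists_schedule_of_lists
    (P := fun l => A.Bivalent k (A.exec (A.initial x) l)) hb fun l p hl => by
      obtain ⟨l', hp, hl'⟩ := exists_bivalent_exec hA hres hobj hg hgn hk p
        ((reachable_initial x).exec l) hl
      exact ⟨l', hp, by rwa [exec_append]⟩
  obtain ⟨i, hi⟩ := hres.exists_decided (reachable_initial x) (R := Finset.univ) (by simp)
    fun p _ => hσ p
  obtain ⟨j, hij, v, w, hvw, ⟨l, hl⟩, ⟨l', hl'⟩⟩ := hbiv i
  have hj : ∀ p, ∃ d, (A.exec (A.initial x) ((List.range j).map σ)).decision p = some d := by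
    intro p
    obtain ⟨d, hd⟩ := hi p (Finset.mem_univ p)
    rw [← run_eq_exec] at hd ⊢
    exact ⟨d, run_decision_eq_some_of_le hij hd⟩
  rw [exec_eq_self_of_forall_decision hj] at hl hl'
  refine hvw (hl.eq_of_decision_eq hl' (R := Finset.univ) ?_ fun _ _ => rfl)
  rw [Finset.card_univ, Fintype.card_fin]
  omega

/-- If at least half of the processes may crash, and the objects are for that many processes, then
only `k` with `2 * k ≤ n + g` are possible. The input assignment `y`, of which each half agrees with
a constant one, would be bivalent otherwise. -/
theorem two_mul_le_of_resilient {k g : ℕ} (hA : A.AgreementWeakValidity k)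
    (hres : A.Resilient g) (hobj : A.UsesObjectsFor g) (hg : 2 ≤ g) (hgn : g < n)
    (hng : n ≤ 2 * g) {a b : α} (hab : a ≠ b) : 2 * k ≤ n + g := by
  by_contra! hk
  have : Nonempty (Fin n) := ⟨⟨0, by omega⟩⟩
  let y : Fin n → α := fun p => if p < g then b else a
  have hval : ∀ e v, A.Yields k (A.initial fun _ => e) v → v = e := by
    rintro e v ⟨l, hl⟩
    obtain ⟨w, ⟨q, rfl⟩, hw⟩ := hA.exists_settled hl.1
    refine hl.eq_of_decision_eq hw (R := Finset.univ) ?_ fun _ _ => rfl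
    rw [Finset.card_univ, Fintype.card_fin]
    omega
  have hsim : ∀ e (S : Finset (Fin n)), S.card ≤ g → (∀ p ∉ S, y p = e) →
      A.Yields k (A.initial y) e := by
    intro e S hS hy
    have h : Similar (A := A) S ∅ (A.initial y) (A.initial fun _ => e) :=
      ⟨fun p hp => by simp [initial, hy p hp], fun _ _ => rfl, rfl, fun _ _ => rfl⟩
    obtain ⟨v, hv, hv'⟩ := h.exists_yields hA hres (by omega) hgn (reachable_initial _)
      (reachable_initial _) fun l => by
        rwa [filter_poised_empty, Finset.union_empty]
    rwa [hval e v hv'] at hv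
  have hcard : (Finset.univ.filter fun p : Fin n => p < g).card = g := by
    rw [Fin.card_filter_val_lt]
    omega
  refine not_bivalent_initial hA hres hobj hg hgn (by omega) y ⟨a, b, hab, ?_, ?_⟩
  · refine hsim a (Finset.univ.filter fun p : Fin n => p < g) hcard.le fun p hp => ?_
    have : ¬ (p : ℕ) < g := by simpa using hp
    simp [y, this]
  · refine hsim b (Finset.univ.filter fun p : Fin n => p < g)ᶜ ?_ fun p hp => ?_
    · rw [Finset.card_compl, hcard, Fintype.card_fin]
      omega
    · have : (p : ℕ) < g := by simpa using hp
      simp [y, this]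

end Algorithm

/-! ### The algorithm -/

namespace QuarterAgreement

/-- The local states of a process. -/
inductive Phase (α : Type) : Type
  /-- about to propose the input `v` to the first object of the group -/
  | start (v : α)
  /-- about to write the value `v` of the group to its register -/
  | announce (v : α)
  /-- about to read the register of the other group -/
  | look (v : α)
  /-- about to propose what was read to the second object of the group -/
  | report (v : α) (s : Option α)
  /-- about to decide, where the group has value `v` and view `s` of the register of the other
  group -/
  | finish (v : α) (s : Option α)

variable {q : ℕ} {α : Type}

/-- The processes form two groups of `2 * q` each; `true` names the first group. -/
def group (p : Fin (4 * q)) : Bool := p.val < 2 * q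

/-- The decision of process `p`, where `v` is the value of its group and `s` the group's view of the
other group's value. A group that sees no value decides on its own. If it sees one, then the second
group adopts it, as does half of the first group. The processes below `q` are the other half of the
first group, so that one formula serves both groups. -/
def rule (p : Fin (4 * q)) (v : α) : Option α → α
  | none => v
  | some w => if p.val < q then v else w

/-- The algorithm, in which each group `b` has a register `b` and objects `(b, false)`, which fixes
the value of the group, and `(b, true)`, which fixes its view of the other group. The proposals to
the objects `(b, false)` have the dummy second component `none`. -/
def algorithm (q : ℕ) (α : Type) : Algorithm (4 * q) α where
  State := Phase α
  Reg := Bool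
  Val := Option α
  Obj := Bool × Bool
  CVal := α × Option α
  regInit _ := none
  start _ v := .start v
  op p
    | .start v => .propose (group p, false) (v, none) fun c => .announce c.1
    | .announce v => .write (group p) (some v) (.look v)
    | .look v => .read (!group p) fun s => .report v s
    | .report v s => .propose (group p, true) (v, s) fun c => .finish c.1 c.2
    | .finish v s => .decide (rule p v s)

lemma update_eq_ite {ι β : Type} {i₁ : DecidableEq ι} {a : ι} {i₂ : ∀ j, Decidable (j = a)}
    (f : ι → β) (b : β) : Function.update f a b = fun j => if j = a then b else f j := by
  funext j
  by_cases h : j = a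
  · subst h; simp
  · simp [h]

/-- Some process of group `b` has found the other register empty, or the group has agreed on this
view. -/
def SeesNone (c : (algorithm q α).Config) (b : Bool) : Prop :=
  (∃ p v, group p = b ∧ c.state p = .report v none) ∨ ∃ v, c.agreed (b, true) = some (v, none)

/-- The invariant of the algorithm for the inputs `x`: what the local states say about the shared
objects, and what the shared objects say about each other. -/
structure Invariant (x : Fin (4 * q) → α) (c : (algorithm q α).Config) : Prop where
  start : ∀ p v, c.state p = .start v →
    x p = v ∧ p ∉ c.users (group p, false) ∧ p ∉ c.users (group p, true)
  announce : ∀ p v, c.state p = .announce v →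
    c.agreed (group p, false) = some (v, none) ∧ p ∉ c.users (group p, true)
  look : ∀ p v, c.state p = .look v → c.reg (group p) = some v ∧ p ∉ c.users (group p, true)
  report : ∀ p v s, c.state p = .report v s →
    c.reg (group p) = some v ∧ (∀ w, s = some w → c.reg (!group p) = some w) ∧
      p ∉ c.users (group p, true)
  finish : ∀ p v s, c.state p = .finish v s → c.agreed (group p, true) = some (v, s)
  decision : ∀ p d, c.decision p = some d →
    ∃ v s, c.agreed (group p, true) = some (v, s) ∧ d = rule p v s
  group_of_mem_users : ∀ b i p, p ∈ c.users (b, i) → group p = b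
  nodup : ∀ b i, (c.users (b, i)).Nodup
  agreed_false : ∀ b v s, c.agreed (b, false) = some (v, s) → s = none ∧ ∃ p, x p = v
  reg : ∀ (b : Bool) (v : α), c.reg b = some v → c.agreed (b, false) = some (v, none)
  agreed_true : ∀ b v s, c.agreed (b, true) = some (v, s) →
    c.reg b = some v ∧ ∀ w, s = some w → c.reg (!b) = some w
  /-- The two groups cannot both miss each other, as each writes before it reads. -/
  seesNone : ∀ b, SeesNone c b → ¬ SeesNone c (!b)

lemma invariant_initial (x : Fin (4 * q) → α) :
    Invariant x ((algorithm q α).initial x) := by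
  constructor <;> simp [Algorithm.initial, algorithm, SeesNone]

set_option maxHeartbeats 1000000 in
lemma Invariant.step {x : Fin (4 * q) → α} {c : (algorithm q α).Config} (h : Invariant x c)
    (p : Fin (4 * q)) : Invariant x ((algorithm q α).step p c) := by
  cases hd : c.decision p with
  | some d => rwa [Algorithm.step_eq_self_of_decision hd]
  | none =>
  obtain ⟨h1, h2, h3, h4, h5, h6, h7, h8, h9, h10, h11, h12⟩ := h
  obtain ⟨state, decision, reg, agreed, users⟩ := c
  change Fin (4 * q) → Phase α at state
  change Bool → Option α at reg
  change Bool × Bool → Option (α × Option α) at agreed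
  change Bool × Bool → Multiset (Fin (4 * q)) at users
  simp only [SeesNone] at *
  cases hs : state p with
  | start v =>
    have e : (algorithm q α).op p (state p) =
      .propose (group p, false) (v, none) fun c => .announce c.1 := by rw [hs]; rfl
    obtain ⟨a, ha, ha'⟩ : ∃ a, (agreed (group p, false)).getD (v, none) = a ∧
        (agreed (group p, false) = some a ∨ agreed (group p, false) = none ∧ a = (v, none)) := by
      cases agreed (group p, false) <;> simp
    obtain ⟨a₁, a₂⟩ := a
    -- The updates are spelled out over `Bool × Bool`, as `(algorithm q α).Obj` hides the pairs.
    have hstep : (algorithm q α).step p ⟨state, decision, reg, agreed, users⟩ =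
        ⟨fun r => (if r = p then .announce a₁ else state r : Phase α), decision, reg,
          fun (o : Bool × Bool) =>
            (if o = (group p, false) then some (a₁, a₂) else agreed o : Option (α × Option α)),
          fun (o : Bool × Bool) =>
            if o = (group p, false) then p ::ₘ users (group p, false) else users o⟩ := by
      simp only [Algorithm.step, hd, e]
      erw [ha]
      congr 1 <;> exact update_eq_ite _ _
    rw [hstep]
    clear hstep e ha
    constructor <;> simp only [SeesNone] <;> grind [Function.update_apply, Multiset.nodup_cons]
  | announce v =>
    have e : (algorithm q α).op p (state p) =
      .write (group p) (some v) (.look v) := by rw [hs]; rfl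
    simp only [Algorithm.step, hd, e]
    constructor <;> simp only [SeesNone] <;> grind [Function.update_apply, Multiset.nodup_cons]
  | look v =>
    have e : (algorithm q α).op p (state p) =
      .read (!group p) fun s => .report v s := by rw [hs]; rfl
    simp only [Algorithm.step, hd, e]
    constructor <;> simp only [SeesNone] <;> grind [Function.update_apply, Multiset.nodup_cons]
  | report v s =>
    have e : (algorithm q α).op p (state p) =
      .propose (group p, true) (v, s) fun c => .finish c.1 c.2 := by rw [hs]; rfl
    obtain ⟨a, ha, ha'⟩ : ∃ a, (agreed (group p, true)).getD (v, s) = a ∧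
        (agreed (group p, true) = some a ∨ agreed (group p, true) = none ∧ a = (v, s)) := by
      cases agreed (group p, true) <;> simp
    obtain ⟨a₁, a₂⟩ := a
    have hstep : (algorithm q α).step p ⟨state, decision, reg, agreed, users⟩ =
        ⟨fun r => (if r = p then .finish a₁ a₂ else state r : Phase α), decision, reg,
          fun (o : Bool × Bool) =>
            (if o = (group p, true) then some (a₁, a₂) else agreed o : Option (α × Option α)),
          fun (o : Bool × Bool) =>
            if o = (group p, true) then p ::ₘ users (group p, true) else users o⟩ := by
      simp only [Algorithm.step, hd, e]
      erw [ha]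
      congr 1 <;> exact update_eq_ite _ _
    rw [hstep]
    clear hstep e ha
    constructor <;> simp only [SeesNone] <;> grind [Function.update_apply, Multiset.nodup_cons]
  | finish v s =>
    have e : (algorithm q α).op p (state p) = .decide (rule p v s) := by rw [hs]; rfl
    simp only [Algorithm.step, hd, e]
    constructor <;> simp only [SeesNone] <;> grind [Function.update_apply, Multiset.nodup_cons]

lemma invariant_run (x : Fin (4 * q) → α) (σ : ℕ → Fin (4 * q)) (i : ℕ) :
    Invariant x ((algorithm q α).run x σ i) := by
  induction i with
  | zero => exact invariant_initial x
  | succ i ih => exact ih.step (σ i)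

/-- The number of operations completed before a local state is reached. -/
def Phase.rank : Phase α → ℕ
  | .start _ => 0
  | .announce _ => 1
  | .look _ => 2
  | .report _ _ => 3
  | .finish _ _ => 4

lemma rank_le_rank_step (c : (algorithm q α).Config) (p r : Fin (4 * q)) :
    (c.state r).rank ≤ (((algorithm q α).step p c).state r).rank := by
  by_cases hr : r = p
  · subst hr
    cases hd : c.decision r with
    | some d => rw [Algorithm.step_eq_self_of_decision hd]
    | none =>
      cases hs : c.state r <;> simp [Algorithm.step, hd, hs, algorithm, Phase.rank]
  · rw [Algorithm.step_state_of_ne hr]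

lemma rank_lt_rank_step {c : (algorithm q α).Config} {p : Fin (4 * q)} (hd : c.decision p = none)
    (hd' : ((algorithm q α).step p c).decision p = none) :
    (c.state p).rank < (((algorithm q α).step p c).state p).rank := by
  cases hs : c.state p <;> simp [Algorithm.step, hd, hs, algorithm, Phase.rank] at hd' ⊢

/-- Every process decides with its fifth step at the latest, whatever the others do. -/
lemma exists_decides_of_infinite (x : Fin (4 * q) → α) {σ : ℕ → Fin (4 * q)} {p : Fin (4 * q)}
    (hσ : {i | σ i = p}.Infinite) : ∃ d, (algorithm q α).Decides x σ p d := by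
  by_contra! hcon
  have hnone : ∀ i, ((algorithm q α).run x σ i).decision p = none := fun i =>
    Option.eq_none_iff_forall_ne_some.2 fun d h => hcon d ⟨i, h⟩
  have hmono : Monotone fun i => (((algorithm q α).run x σ i).state p).rank :=
    monotone_nat_of_le_succ fun i => rank_le_rank_step _ _ _
  have h : ∀ j, ∃ i, j ≤ (((algorithm q α).run x σ i).state p).rank := by
    intro j
    induction j with
    | zero => exact ⟨0, Nat.zero_le _⟩
    | succ j ih =>
      obtain ⟨i, hi⟩ := ih
      obtain ⟨i', hi', hlt⟩ := hσ.exists_gt i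
      have hi' : σ i' = p := hi'
      refine ⟨i' + 1, ?_⟩
      have h1 := hmono hlt.le
      have h2 := rank_lt_rank_step (hnone i') (by simpa [Algorithm.run, hi'] using hnone (i' + 1))
      simp only [Algorithm.run, hi'] at h1 h2 ⊢
      omega
  obtain ⟨i, hi⟩ := h 5
  cases hs : ((algorithm q α).run x σ i).state p <;> simp [hs, Phase.rank] at hi

lemma resilient (q : ℕ) (α : Type) (t : ℕ) : (algorithm q α).Resilient t := by
  intro x σ _ p hp
  by_contra! hcon
  refine hp ⟨?_, hcon⟩
  by_contra hinf
  obtain ⟨d, hd⟩ := exists_decides_of_infinite x hinf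
  exact hcon d hd

lemma card_group_le (q : ℕ) (b : Bool) :
    (Finset.univ.filter fun p : Fin (4 * q) => group p = b).card ≤ 2 * q := by
  have h := Finset.card_filter_add_card_filter_not (s := Finset.univ)
    (fun p : Fin (4 * q) => p.val < 2 * q)
  rw [Finset.card_univ, Fintype.card_fin, Fin.card_filter_val_lt] at h
  cases b
  · simp only [group, decide_eq_false_iff_not]
    omega
  · simp only [group, decide_eq_true_eq, Fin.card_filter_val_lt]
    omega

lemma usesObjectsFor (q : ℕ) (α : Type) : (algorithm q α).UsesObjectsFor (2 * q) := by
  rintro x σ i ⟨b, j⟩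
  have h := invariant_run x σ i
  refine ⟨h.nodup b j, ?_⟩
  rw [← Multiset.toFinset_card_of_nodup (h.nodup b j)]
  refine (Finset.card_le_card fun p hp => ?_).trans (card_group_le q b)
  simpa using h.group_of_mem_users b j p (Multiset.mem_toFinset.1 hp)

/-- The value of a group and the value it has seen are inputs. -/
lemma Invariant.exists_input {x : Fin (4 * q) → α} {c : (algorithm q α).Config}
    (h : Invariant x c) {b : Bool} {v : α} {s : Option α} (hb : c.agreed (b, true) = some (v, s)) :
    (∃ p, x p = v) ∧ ∀ w, s = some w → ∃ p, x p = w := by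
  obtain ⟨h1, h2⟩ := h.agreed_true b v s hb
  exact ⟨(h.agreed_false _ _ _ (h.reg _ _ h1)).2, fun w hw =>
    (h.agreed_false _ _ _ (h.reg _ _ (h2 w hw))).2⟩

lemma strongValidity (q : ℕ) (α : Type) : (algorithm q α).StrongValidity := by
  rintro x σ p d ⟨i, hi⟩
  have h := invariant_run x σ i
  obtain ⟨v, s, hvs, rfl⟩ := h.decision p d hi
  obtain ⟨hv, hs⟩ := h.exists_input hvs
  cases s with
  | none => exact hv
  | some w =>
    unfold rule
    split_ifs
    · exact hv
    · exact hs w rfl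

/-- All decisions but those of one half of the first group coincide: only if the first group has
seen the value of the second group are its halves divided, and then the second group decides
uniformly. -/
lemma Invariant.exists_common {x : Fin (4 * q) → α} {c : (algorithm q α).Config}
    (h : Invariant x c) (hq : 0 < q) : ∃ v, (∃ p, x p = v) ∧
      ((∀ p d, c.decision p = some d → d ≠ v → p.val < q) ∨
        ∀ p d, c.decision p = some d → d ≠ v → q ≤ p.val ∧ p.val < 2 * q) := by
  have hdec : ∀ p d, c.decision p = some d →
      (p.val < 2 * q ∧ ∃ v s, c.agreed (true, true) = some (v, s) ∧ d = rule p v s) ∨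
      (2 * q ≤ p.val ∧ ∃ v s, c.agreed (false, true) = some (v, s) ∧ d = rule p v s) := by
    intro p d hp
    have hd := h.decision p d hp
    cases hg : group p <;> rw [hg] at hd
    · exact .inr ⟨by simpa [group] using hg, hd⟩
    · exact .inl ⟨by simpa [group] using hg, hd⟩
  have hnone : ∀ v w, c.agreed (true, true) = some (v, none) →
      c.agreed (false, true) ≠ some (w, none) := fun v w hv hw =>
    h.seesNone true (.inr ⟨v, hv⟩) (.inr ⟨w, hw⟩)
  have hsome : ∀ b v s w u, c.agreed (b, true) = some (v, s) →
      c.agreed (!b, true) = some (w, some u) → u = v := by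
    intro b v s w u hv hw
    have h1 := (h.agreed_true _ _ _ hv).1
    have h2 := (h.agreed_true _ _ _ hw).2 u rfl
    rw [Bool.not_not, h1] at h2
    exact (Option.some.inj h2).symm
  have hft := hsome false
  have htf := hsome true
  simp only [Bool.not_false, Bool.not_true] at hft htf
  rcases h2 : c.agreed (false, true) with _ | ⟨b, _ | y⟩
  · rcases h1 : c.agreed (true, true) with _ | ⟨a, s⟩
    · exact ⟨x ⟨0, by omega⟩, ⟨_, rfl⟩, .inl fun p d hp _ => by grind⟩
    · refine ⟨a, (h.exists_input h1).1, .inr fun p d hp hne => ?_⟩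
      rcases hdec p d hp with ⟨hlt, v, s, hv, rfl⟩ | ⟨hge, v, s, hv, rfl⟩ <;>
        rcases s with _ | s <;> grind [rule]
  · refine ⟨b, (h.exists_input h2).1, .inl fun p d hp hne => ?_⟩
    rcases hdec p d hp with ⟨hlt, v, s, hv, rfl⟩ | ⟨hge, v, s, hv, rfl⟩
    · rcases s with _ | s
      · exact absurd h2 (hnone _ _ hv)
      · have := hft _ _ _ _ h2 hv
        grind [rule]
    · grind [rule]
  · rcases h1 : c.agreed (true, true) with _ | ⟨a, s⟩
    · refine ⟨y, (h.exists_input h2).2 y rfl, .inr fun p d hp hne => ?_⟩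
      grind [rule]
    · refine ⟨a, (h.exists_input h1).1, .inr fun p d hp hne => ?_⟩
      have := htf _ _ _ _ h1 h2
      cases s <;> grind [rule]

lemma agreementWeakValidity {q : ℕ} (hq : 0 < q) (α : Type) {k : ℕ} (hk : k ≤ 3 * q) :
    (algorithm q α).AgreementWeakValidity k := by
  intro x σ
  obtain ⟨i, hi⟩ := (algorithm q α).exists_forall_decides x σ
  obtain ⟨v, hv, h⟩ := (invariant_run x σ i).exists_common hq
  refine ⟨v, hv, ?_⟩
  suffices {p | ∃ d, (algorithm q α).Decides x σ p d ∧ d ≠ v}.ncard ≤ q by omega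
  have hcard : ∀ a, {p : Fin (4 * q) | a ≤ p.val ∧ p.val < a + q}.ncard ≤ q := by
    intro a
    have := Set.ncard_le_ncard_of_injOn (t := (Finset.Ico a (a + q) : Set ℕ)) Fin.val
      (s := {p : Fin (4 * q) | a ≤ p.val ∧ p.val < a + q}) (by simp) Fin.val_injective.injOn
    rwa [Set.ncard_coe_finset, Nat.card_Ico, Nat.add_sub_cancel_left] at this
  rcases h with h | h
  · refine (Set.ncard_le_ncard ?_ (Set.toFinite _)).trans (hcard 0)
    rintro p ⟨d, hd, hne⟩
    have := h p d (hi p d hd) hne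
    exact ⟨Nat.zero_le _, by omega⟩
  · refine (Set.ncard_le_ncard ?_ (Set.toFinite _)).trans (hcard q)
    rintro p ⟨d, hd, hne⟩
    have := h p d (hi p d hd) hne
    exact ⟨this.1, by omega⟩

end QuarterAgreement

/-! ### Solvability -/

theorem corollary5 (n m k : ℕ) (hn : 2 ≤ n) (hm : 2 ≤ m) (h4 : 4 ∣ n) :
    (PartialAgreementSolvable n k m (n / 2) (n / 2) ↔ k ≤ 3 * n / 4) ∧
      (StrongPartialAgreementSolvable n k m (n / 2) (n / 2) ↔ k ≤ 3 * n / 4) := by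
  obtain ⟨q, rfl⟩ := h4
  have h2 : 4 * q / 2 = 2 * q := by omega
  have h3 : 3 * (4 * q) / 4 = 3 * q := by omega
  rw [h2, h3]
  have himp : PartialAgreementSolvable (4 * q) k m (2 * q) (2 * q) → k ≤ 3 * q := by
    rintro ⟨A, hobj, hA, hres⟩
    have := Algorithm.two_mul_le_of_resilient hA hres hobj (by omega) (by omega) (by omega)
      (a := ⟨0, by omega⟩) (b := ⟨1, by omega⟩) (by simp)
    omega
  have hsol : k ≤ 3 * q → StrongPartialAgreementSolvable (4 * q) k m (2 * q) (2 * q) := fun hk =>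
    ⟨QuarterAgreement.algorithm q (Fin m), QuarterAgreement.usesObjectsFor q _,
      QuarterAgreement.agreementWeakValidity (by omega) _ hk,
      QuarterAgreement.strongValidity q _, QuarterAgreement.resilient q _ _⟩
  have hweak : StrongPartialAgreementSolvable (4 * q) k m (2 * q) (2 * q) →
      PartialAgreementSolvable (4 * q) k m (2 * q) (2 * q) := fun ⟨A, hobj, hA, _, hres⟩ =>
    ⟨A, hobj, hA, hres⟩
  exact ⟨⟨himp, fun hk => hweak (hsol hk)⟩, ⟨fun h => himp (hweak h), hsol⟩⟩
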